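/- Let $\mathbf G$ be a connected linear algebraic group defined over $\mathbb R$, and let $G=\mathbf G(\mathbb R)^\circ$ be the connected component of the identity in the Lie group $\mathbf G(\mathbb R)$. Let $\Gamma\subset G$ be a torsion-free lattice, let $X=G/\Gamma$, and let $\mu_X$ denote the $G$-invariant Borel probability measure on $X$. Let $H\subset G$ be a connected semisimple Lie subgroup such that $$\bigcap_{g\in G} gHg^{-1}$$ is a finite group. Then for $\mu_X$-almost every $x\in X$, $$\mathrm{Stab}_G(x)\cap H=\{e\},$$ where $\mathrm{Stab}_G(x)=\{g\in G: gx=x\}$. -/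

import Mathlib

open MeasureTheory


/-- A subset of `GL_N(ℂ)` that is the zero locus, inside `GL_N(ℂ)`, of a set of polynomials in the
matrix entries with coefficients in `k`. For `k = ℂ` these are the Zariski closed subsets; for
`k = ℝ` they are the Zariski closed subsets defined over `ℝ`. -/
def IsZariskiClosedOver (k : Type*) [CommSemiring k] [Algebra k ℂ] {N : ℕ}
    (Z : Set (GL (Fin N) ℂ)) : Prop :=
  ∃ S : Set (MvPolynomial (Fin N × Fin N) k),
    Z = {g : GL (Fin N) ℂ | ∀ p ∈ S, MvPolynomial.aeval
      (fun ij : Fin N × Fin N => (g : Matrix (Fin N) (Fin N) ℂ) ij.1 ij.2) p = 0}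

/-- `Z ⊆ GL_N(ℂ)` is nonempty and is not the union of two disjoint nonempty relatively Zariski
closed subsets. -/
def IsZariskiConnected {N : ℕ} (Z : Set (GL (Fin N) ℂ)) : Prop :=
  Z.Nonempty ∧ ∀ A B : Set (GL (Fin N) ℂ), IsZariskiClosedOver ℂ A → IsZariskiClosedOver ℂ B →
    Z ⊆ A ∪ B → Z ∩ A ∩ B = ∅ → Z ⊆ A ∨ Z ⊆ B

/-- A connected linear algebraic group defined over `ℝ`, given by its group of complex points
as a subgroup of `GL_N(ℂ)`. -/
structure IsConnectedAlgebraicGroupOverReal {N : ℕ} (GC : Subgroup (GL (Fin N) ℂ)) : Prop where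
  closed : IsZariskiClosedOver ℝ (GC : Set (GL (Fin N) ℂ))
  connected : IsZariskiConnected (GC : Set (GL (Fin N) ℂ))

/-- The group `GC(ℝ)` of real points. -/
noncomputable def realPoints {N : ℕ} (GC : Subgroup (GL (Fin N) ℂ)) : Subgroup (GL (Fin N) ℝ) :=
  GC.comap (Matrix.GeneralLinearGroup.map (algebraMap ℝ ℂ))

/-- The connected component `GC(ℝ)°` of the identity in `GC(ℝ)`, for the Hausdorff (Lie group)
topology. -/
noncomputable def realIdentityComponent {N : ℕ} (GC : Subgroup (GL (Fin N) ℂ)) : Subgroup (GL (Fin N) ℝ) :=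
  (Subgroup.connectedComponentOfOne (realPoints GC)).map (realPoints GC).subtype

section

attribute [local instance] LieRing.ofAssociativeRing

/-- A subgroup of `GL_N(ℝ)` is a connected semisimple Lie (sub)group if it is the connected Lie
subgroup (generated by exponentials) of a semisimple Lie subalgebra of `𝔤𝔩_N(ℝ)`. It is not
required to be closed. -/
def IsConnectedSemisimpleLieSubgroup {N : ℕ} (H : Subgroup (GL (Fin N) ℝ)) : Prop :=
  ∃ 𝔥 : LieSubalgebra ℝ (Matrix (Fin N) (Fin N) ℝ), LieAlgebra.IsSemisimple ℝ 𝔥 ∧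
    H = Subgroup.closure {g : GL (Fin N) ℝ | ∃ Y ∈ 𝔥, (g : Matrix (Fin N) (Fin N) ℝ) = NormedSpace.exp Y}

end

/-- A measure on `G ⧸ Γ` that is a `G`-invariant probability measure (for the action by left
translation). -/
structure IsInvariantProbability {G : Type*} [Group G] (Γ : Subgroup G)
    [MeasurableSpace (G ⧸ Γ)] (μ : Measure (G ⧸ Γ)) : Prop where
  prob : IsProbabilityMeasure μ
  invariant : SMulInvariantMeasure G (G ⧸ Γ) μ

/-- A lattice: a discrete subgroup `Γ` such that `G ⧸ Γ` carries a `G`-invariant Borel probability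
measure. -/
structure IsLatticeSubgroup {G : Type*} [Group G] [TopologicalSpace G] (Γ : Subgroup G) : Prop where
  discrete : DiscreteTopology Γ
  finite_covolume : ∃ μ : @Measure (G ⧸ Γ) (borel (G ⧸ Γ)),
    @IsInvariantProbability G _ Γ (borel (G ⧸ Γ)) μ

/-! The stabiliser of `gΓ` is `gΓg⁻¹`, and `Γ` is countable. So it suffices that for each `γ ≠ 1` in
`Γ` the set of `g` conjugating `γ` into `H` is Haar-null; a Fubini argument
(`measure_eq_zero_of_preimage_haar_null`) carries nullity to `μ`.

Suppose that the set has positive measure (`conj_mem_of_measure_pos`). `H` is a countable union of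
pieces `exp(small ball of 𝔥) * d`, so one piece receives `g⁻¹γg` for a set `T` of positive measure.
By Steinhaus, `T ∩ uT` has positive measure for every `u` near `1`. Comparing `g` with `u⁻¹g`, both
in `T`, cancels `d`: writing `uγu⁻¹γ⁻¹ = exp L`, one gets `g⁻¹Lg ∈ 𝔥` for a positive-measure set of
`g`. A maximal-subspace argument (`exists_invariant_submodule`) puts `L` in an `Ad(G)`-invariant
subspace of `𝔥`, whose exponentials lie in the finite core of `H`; hence `L = 0`. Thus `γ` commutes
with a neighbourhood of `1`, so with the connected group `G`. Being central, `γ` lies in the core,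
so it has finite order, contradicting torsion-freeness.

`H` need not be closed, so the countable cover is proved from a local group law for `exp 𝔥`. -/

open NormedSpace Topology Filter Set

/-! ### Exponential calculus in a Banach algebra -/

section ExpCalculus

variable {A : Type*} [NormedRing A] [NormedAlgebra ℝ A]

/-- `ad Y` as a continuous linear map. -/
noncomputable def adL (Y : A) : A →L[ℝ] A :=
  ContinuousLinearMap.mul ℝ A Y - (ContinuousLinearMap.mul ℝ A).flip Y

theorem adL_apply (Y V : A) : adL Y V = Y * V - V * Y := rfl

variable [CompleteSpace A]

theorem continuous_exp_real : Continuous (exp : A → A) := by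
  let _ := NormedAlgebra.restrictScalars ℚ ℝ A
  exact exp_continuous

theorem exp_add_real {x y : A} (h : Commute x y) : exp (x + y) = exp x * exp y := by
  let _ := NormedAlgebra.restrictScalars ℚ ℝ A
  exact exp_add_of_commute h

theorem exp_mul_exp_neg (x : A) : exp x * exp (-x) = 1 := by
  rw [← exp_add_real (Commute.neg_right (Commute.refl x)), add_neg_cancel, exp_zero]

theorem exp_neg_mul_exp (x : A) : exp (-x) * exp x = 1 := by
  rw [← exp_add_real (Commute.neg_left (Commute.refl x)), neg_add_cancel, exp_zero]

theorem exp_nsmul_real (n : ℕ) (x : A) : exp (n • x) = exp x ^ n := by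
  let _ := NormedAlgebra.restrictScalars ℚ ℝ A
  exact exp_nsmul n x

theorem exp_units_conj_real (y : Aˣ) (x : A) : exp (y * x * ↑y⁻¹ : A) = y * exp x * ↑y⁻¹ := by
  let _ := NormedAlgebra.restrictScalars ℚ ℝ A
  exact exp_units_conj y x

/-- The exponential as an element of the unit group. -/
noncomputable def expUnit (x : A) : Aˣ where
  val := exp x
  inv := exp (-x)
  val_inv := exp_mul_exp_neg x
  inv_val := exp_neg_mul_exp x

theorem contDiff_exp_real : ContDiff ℝ 1 (exp : A → A) := by
  rw [contDiff_iff_contDiffAt]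
  intro x
  exact (exp_analytic (𝕂 := ℝ) x).contDiffAt

/-- Conjugating the solution `E` of `E' = [Y, E]` back by `exp (tY)` gives a curve with zero
derivative. -/
theorem exp_adL_apply (Y V : A) : exp (adL Y) V = exp Y * V * exp (-Y) := by
  set E : ℝ → A := fun t => exp (t • adL Y) V
  have hE : ∀ t, HasDerivAt E (adL Y (E t)) t := by
    intro t
    have := hasDerivAt_exp_smul_const' (𝕂 := ℝ) (adL Y) t
    have h2 := (ContinuousLinearMap.apply ℝ A V).hasFDerivAt.comp_hasDerivAt t this
    exact h2
  have hf : ∀ t, HasDerivAt (fun t : ℝ => exp (t • (-Y)) * E t * exp (t • Y)) 0 t := by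
    intro t
    have h1 := hasDerivAt_exp_smul_const (𝕂 := ℝ) (-Y) t
    have h2 := hasDerivAt_exp_smul_const' (𝕂 := ℝ) Y t
    have := (h1.mul (hE t)).mul h2
    refine HasDerivAt.congr_deriv (f := fun t : ℝ => exp (t • (-Y)) * E t * exp (t • Y)) this ?_
    rw [adL_apply, Pi.mul_apply]
    noncomm_ring
  have hc := is_const_of_deriv_eq_zero (fun t => (hf t).differentiableAt) (fun t => (hf t).deriv) 1 0
  simp only [one_smul, zero_smul, exp_zero, one_mul, mul_one, E] at hc
  have h0 : (0 : ℝ) • adL Y = 0 := zero_smul ℝ (adL Y)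
  rw [h0, exp_zero, one_apply_eq_self] at hc
  calc exp (adL Y) V = (exp Y * exp (-Y)) * exp (adL Y) V * (exp Y * exp (-Y)) := by
        rw [exp_mul_exp_neg]; simp
    _ = exp Y * (exp (-Y) * exp (adL Y) V * exp Y) * exp (-Y) := by noncomm_ring
    _ = _ := by rw [hc]

end ExpCalculus

/-! ### Lie subalgebras under `Ad` and the differential of `exp` -/

section LieSubalg

variable {A : Type*} [NormedRing A] [NormedAlgebra ℝ A] [FiniteDimensional ℝ A]
  {𝔥 : Submodule ℝ A}

/-- The partial sums of `exp (ad Y) V` lie in `𝔥`, which is closed by finite dimension. -/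
theorem exp_mul_mul_exp_neg_mem (h𝔥 : ∀ X ∈ 𝔥, ∀ Y ∈ 𝔥, X * Y - Y * X ∈ 𝔥)
    {Y V : A} (hY : Y ∈ 𝔥) (hV : V ∈ 𝔥) : exp Y * V * exp (-Y) ∈ 𝔥 := by
  have _ : CompleteSpace A := FiniteDimensional.complete ℝ A
  have hcl : IsClosed (𝔥 : Set A) := 𝔥.closed_of_finiteDimensional
  rw [← exp_adL_apply]
  have hs := exp_series_hasSum_exp' (𝕂 := ℝ) (adL Y)
  have hs2 := hs.mapL (ContinuousLinearMap.apply ℝ A V)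
  refine hcl.mem_of_tendsto hs2 (Eventually.of_forall fun s => 𝔥.sum_mem fun n hn => ?_)
  simp only [map_smul]
  refine 𝔥.smul_mem _ ?_
  change ((adL Y) ^ n) V ∈ 𝔥
  clear hn
  induction n with
  | zero => simpa using hV
  | succ n ih =>
    rw [pow_succ', mul_apply_eq_comp, adL_apply]
    exact h𝔥 _ hY _ ih

theorem exp_neg_mul_mul_exp_mem (h𝔥 : ∀ X ∈ 𝔥, ∀ Y ∈ 𝔥, X * Y - Y * X ∈ 𝔥)
    {Y V : A} (hY : Y ∈ 𝔥) (hV : V ∈ 𝔥) : exp (-Y) * V * exp Y ∈ 𝔥 := by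
  simpa using exp_mul_mul_exp_neg_mem h𝔥 (𝔥.neg_mem hY) hV

/-- The right-trivialised differential of `exp` maps a Lie subalgebra to itself. -/
theorem fderiv_exp_mul_exp_neg_mem (h𝔥 : ∀ X ∈ 𝔥, ∀ Y ∈ 𝔥, X * Y - Y * X ∈ 𝔥)
    {Y V : A} (hY : Y ∈ 𝔥) (hV : V ∈ 𝔥) : fderiv ℝ exp Y V * exp (-Y) ∈ 𝔥 := by
  have _ : CompleteSpace A := FiniteDimensional.complete ℝ A
  have hcl : IsClosed (𝔥 : Set A) := 𝔥.closed_of_finiteDimensional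
  -- Duhamel's formula: integrate the derivative of `exp (t(Y + sV)) * exp (-tY)` over `[0,1]`,
  -- divide by `s`, and let `s → 0`. The limit is an average of `Ad (exp tY) V`, hence lies in the
  -- closed convex set `𝔥`.
  set F : ℝ → ℝ → A := fun s t => exp (t • (Y + s • V)) * V * exp (-(t • Y))
  have hFc : Continuous (fun p : ℝ × ℝ => F p.1 p.2) := by
    have := continuous_exp_real (A := A)
    fun_prop
  have hduh : ∀ s : ℝ, exp (Y + s • V) * exp (-Y) - 1 = s • ∫ t in (0:ℝ)..1, F s t := by
    intro s
    have hd : ∀ t : ℝ, HasDerivAt (fun t : ℝ => exp (t • (Y + s • V)) * exp (t • (-Y)))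
        (s • F s t) t := by
      intro t
      have h1 := hasDerivAt_exp_smul_const (𝕂 := ℝ) (Y + s • V) t
      have h2 := hasDerivAt_exp_smul_const' (𝕂 := ℝ) (-Y) t
      refine HasDerivAt.congr_deriv
        (f := fun t : ℝ => exp (t • (Y + s • V)) * exp (t • (-Y))) (h1.mul h2) ?_
      simp only [F, smul_neg]
      simp only [mul_add, add_mul, mul_neg, neg_mul, mul_smul_comm, smul_mul_assoc, mul_assoc]
      abel
    have hi : IntervalIntegrable (fun t => s • F s t) volume 0 1 := by
      apply Continuous.intervalIntegrable
      exact (hFc.comp (Continuous.prodMk_right s)).const_smul s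
    have := intervalIntegral.integral_eq_sub_of_hasDerivAt (fun t _ => hd t) hi
    simp only [one_smul, zero_smul, exp_zero, mul_one, intervalIntegral.integral_smul] at this
    exact this.symm
  have hI : Tendsto (fun s : ℝ => ∫ t in (0:ℝ)..1, F s t) (𝓝 0) (𝓝 (∫ t in (0:ℝ)..1, F 0 t)) :=
    (intervalIntegral.continuous_parametric_intervalIntegral_of_continuous' hFc 0 1).tendsto 0
  have hD : HasDerivAt (fun s : ℝ => exp (Y + s • V) * exp (-Y))
      (fderiv ℝ exp Y V * exp (-Y)) 0 := by
    have h1 : HasFDerivAt (exp : A → A) (fderiv ℝ exp Y) (Y + (0:ℝ) • V) := by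
      simpa using (contDiff_exp_real.differentiable (by simp) Y).hasFDerivAt
    have h2 : HasDerivAt (fun s : ℝ => Y + s • V) V 0 := by
      simpa using ((hasDerivAt_id (0:ℝ)).smul_const V).const_add Y
    exact (h1.comp_hasDerivAt (0:ℝ) h2).mul_const _
  have hD2 := hD.tendsto_slope_zero
  have heq : fderiv ℝ exp Y V * exp (-Y) = ∫ t in (0:ℝ)..1, F 0 t := by
    refine tendsto_nhds_unique hD2 ((hI.mono_left nhdsWithin_le_nhds).congr' ?_)
    filter_upwards [self_mem_nhdsWithin] with s hs
    have hs' : s ≠ 0 := hs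
    have := hduh s
    simp only [zero_add, zero_smul, add_zero, exp_mul_exp_neg]
    rw [this, smul_smul, inv_mul_cancel₀ hs', one_smul]
  rw [heq, intervalIntegral.integral_of_le zero_le_one]
  have hF0 : ∀ t, F 0 t ∈ 𝔥 := fun t => by
    simp only [F, zero_smul, add_zero]
    exact exp_mul_mul_exp_neg_mem h𝔥 (𝔥.smul_mem t hY) hV
  have hi : IntegrableOn (F 0) (Ioc 0 1) volume :=
    ((hFc.comp (Continuous.prodMk_right (0:ℝ))).integrableOn_Icc).mono_set Ioc_subset_Icc_self
  have _ : IsProbabilityMeasure (volume.restrict (Ioc (0:ℝ) 1)) := ⟨by simp⟩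
  exact 𝔥.convex.integral_mem hcl (Eventually.of_forall hF0) hi

end LieSubalg

/-! ### The local group law -/

section LocalGroup

variable {A : Type*} [NormedRing A] [NormedAlgebra ℝ A]

theorem hasStrictFDerivAt_exp_zero_equiv [CompleteSpace A] :
    HasStrictFDerivAt (exp : A → A) ((ContinuousLinearEquiv.refl ℝ A : A ≃L[ℝ] A) : A →L[ℝ] A) 0 :=
  hasStrictFDerivAt_exp_zero (𝕂 := ℝ) (𝔸 := A)

theorem exists_injOn_exp_ball [CompleteSpace A] :
    ∃ r > 0, InjOn (exp : A → A) (Metric.ball 0 r) := by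
  have h := (hasStrictFDerivAt_exp_zero_equiv (A := A)).eventually_left_inverse
  obtain ⟨r, hr, hb⟩ := Metric.eventually_nhds_iff_ball.1 h
  refine ⟨r, hr, fun x hx y hy hxy => ?_⟩
  rw [← hb x hx, ← hb y hy, hxy]

theorem exp_image_ball_mem_nhds [CompleteSpace A] {r : ℝ} (hr : 0 < r) :
    (exp : A → A) '' Metric.ball 0 r ∈ 𝓝 (1 : A) := by
  have h := (hasStrictFDerivAt_exp_zero_equiv (A := A)).map_nhds_eq_of_equiv
  rw [exp_zero] at h
  rw [← h]
  exact image_mem_map (Metric.ball_mem_nhds 0 hr)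

/-- If `exp (p t).1 * (1 + (p t).2)` has logarithmic derivative in the Lie algebra `𝔥`, where `p`
takes values in `𝔥 × C` with `C` complementary to `𝔥` and `(p t).2` small, then the
component in `C` has zero derivative. -/
theorem deriv_complement_eq_zero [FiniteDimensional ℝ A] {𝔥 C : Submodule ℝ A}
    (h𝔥 : ∀ X ∈ 𝔥, ∀ Y ∈ 𝔥, X * Y - Y * X ∈ 𝔥)
    (π : A →L[ℝ] A) (hπ : ∀ x ∈ 𝔥, π x = x) (hπC : ∀ x ∈ C, π x = 0)
    {Z Y Y' c c' : A} (hZ : Z ∈ 𝔥) (hY : Y ∈ 𝔥) (hY' : Y' ∈ 𝔥) (hc' : c' ∈ C)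
    (hsmall : ‖π‖ * ‖c‖ < 1)
    (heq : fderiv ℝ exp Y Y' * (1 + c) + exp Y * c' = Z * (exp Y * (1 + c))) : c' = 0 := by
  have _ : CompleteSpace A := FiniteDimensional.complete ℝ A
  set D := fderiv ℝ exp Y Y' * exp (-Y)
  have hD : D ∈ 𝔥 := fderiv_exp_mul_exp_neg_mem h𝔥 hY hY'
  set W := exp (-Y) * (Z - D) * exp Y
  have hW : W ∈ 𝔥 := exp_neg_mul_mul_exp_mem h𝔥 hY (𝔥.sub_mem hZ hD)
  have hDe : fderiv ℝ exp Y Y' = D * exp Y := by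
    simp only [D, mul_assoc, exp_neg_mul_exp, mul_one]
  -- Since `c'` is in `C` and `W` in `𝔥`, applying `π` leaves `W = -π (W * c)`; smallness of `c`
  -- then forces `W = 0`.
  have h1 : c' = W + W * c := by
    have : exp Y * c' = (Z - D) * exp Y * (1 + c) := by
      rw [hDe] at heq
      rw [eq_sub_of_add_eq' heq]
      noncomm_ring
    calc c' = exp (-Y) * (exp Y * c') := by rw [← mul_assoc, exp_neg_mul_exp, one_mul]
      _ = W * (1 + c) := by rw [this]; simp only [W, mul_assoc]
      _ = _ := by rw [mul_add, mul_one]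
  have h2 : W = - π (W * c) := by
    have := congrArg π h1
    rw [hπC _ hc', map_add, hπ _ hW] at this
    exact eq_neg_of_add_eq_zero_left this.symm
  have hW0 : W = 0 := by
    by_contra hne
    have hpos : 0 < ‖W‖ := norm_pos_iff.2 hne
    have : ‖W‖ ≤ ‖π‖ * ‖c‖ * ‖W‖ := by
      calc ‖W‖ = ‖π (W * c)‖ := by conv_lhs => rw [h2, norm_neg]
        _ ≤ ‖π‖ * ‖W * c‖ := π.le_opNorm _
        _ ≤ ‖π‖ * (‖W‖ * ‖c‖) := by gcongr; exact norm_mul_le _ _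
        _ = _ := by ring
    nlinarith
  rw [h1, hW0]; simp

/-- The local group law: products of exponentials of small elements of a Lie subalgebra are
exponentials of small elements of the Lie subalgebra. -/
theorem exists_exp_mul_exp_eq_exp [FiniteDimensional ℝ A] {𝔥 : Submodule ℝ A}
    (h𝔥 : ∀ X ∈ 𝔥, ∀ Y ∈ 𝔥, X * Y - Y * X ∈ 𝔥) {ε : ℝ} (hε : 0 < ε) :
    ∃ δ > 0, ∀ X ∈ 𝔥, ‖X‖ ≤ δ → ∀ Y ∈ 𝔥, ‖Y‖ ≤ δ → ∃ Z ∈ 𝔥, ‖Z‖ ≤ ε ∧ exp X * exp Y = exp Z := by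
  have _ : CompleteSpace A := FiniteDimensional.complete ℝ A
  obtain ⟨C, hC⟩ := 𝔥.exists_isCompl
  let e : (𝔥 × C) ≃L[ℝ] A := (Submodule.prodEquivOfIsCompl 𝔥 C hC).toContinuousLinearEquiv
  have he : ∀ p : 𝔥 × C, e p = (p.1 : A) + p.2 := fun p => rfl
  let π : A →L[ℝ] A := 𝔥.subtypeL.comp ((ContinuousLinearMap.fst ℝ 𝔥 C).comp
    (e.symm : A →L[ℝ] 𝔥 × C))
  have hπe : ∀ p : 𝔥 × C, π (e p) = p.1 := fun p => by simp [π]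
  have hπ : ∀ x ∈ 𝔥, π x = x := fun x hx => by
    have := hπe (⟨x, hx⟩, 0); simpa [he] using this
  have hπC : ∀ x ∈ C, π x = 0 := fun x hx => by
    have := hπe (0, ⟨x, hx⟩); simpa [he] using this
  -- A chart near `1` in which `exp 𝔥` is the slice with zero second coordinate; its derivative at
  -- `0` is the isomorphism `e`.
  let Φ : 𝔥 × C → A := fun p => exp (p.1 : A) * (1 + (p.2 : A))
  have hΦ : ContDiff ℝ 1 Φ := by
    refine ContDiff.mul ?_ ?_
    · exact contDiff_exp_real.comp (𝔥.subtypeL.contDiff.comp contDiff_fst)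
    · exact contDiff_const.add (C.subtypeL.contDiff.comp contDiff_snd)
  have hΦ0 : Φ 0 = 1 := by simp [Φ, exp_zero]
  have hd : HasFDerivAt Φ (e : (𝔥 × C) →L[ℝ] A) 0 := by
    have h1 : HasFDerivAt (fun p : 𝔥 × C => exp (p.1 : A))
        ((1 : A →L[ℝ] A).comp (𝔥.subtypeL.comp (ContinuousLinearMap.fst ℝ 𝔥 C))) 0 := by
      have h0 : HasFDerivAt (exp : A → A) (1 : A →L[ℝ] A)
          ((𝔥.subtypeL.comp (ContinuousLinearMap.fst ℝ 𝔥 C)) 0) := by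
        rw [map_zero]; exact hasFDerivAt_exp_zero (𝕂 := ℝ)
      exact h0.comp (0 : 𝔥 × C) (ContinuousLinearMap.hasFDerivAt _)
    have h2 : HasFDerivAt (fun p : 𝔥 × C => 1 + (p.2 : A))
        (C.subtypeL.comp (ContinuousLinearMap.snd ℝ 𝔥 C)) 0 :=
      (ContinuousLinearMap.hasFDerivAt (C.subtypeL.comp (ContinuousLinearMap.snd ℝ 𝔥 C))).const_add 1
    refine (h1.mul' h2).congr_fderiv ?_
    ext p <;> simp [he, exp_zero]
  let ψ := hΦ.contDiffAt.localInverse hd one_ne_zero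
  have hψ1 : ψ 1 = 0 := by
    have := hΦ.contDiffAt.localInverse_apply_image hd one_ne_zero
    rwa [hΦ0] at this
  have hψc : ContDiffAt ℝ 1 ψ 1 := by
    have := hΦ.contDiffAt.to_localInverse hd one_ne_zero
    rwa [hΦ0] at this
  have hst := hΦ.contDiffAt.hasStrictFDerivAt' hd one_ne_zero
  have hright : ∀ᶠ x in 𝓝 (1 : A), Φ (ψ x) = x := by
    have := hst.eventually_right_inverse
    rwa [hΦ0] at this
  have hleft : ∀ᶠ p in 𝓝 (0 : 𝔥 × C), ψ (Φ p) = p := hst.eventually_left_inverse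
  -- The first bound gives `‖Z‖ ≤ ε`, the second the smallness required by
  -- `deriv_complement_eq_zero`.
  set η := min ε (1 / (‖π‖ + 1))
  have hη : 0 < η := by positivity
  have hdiff : ∀ᶠ x in 𝓝 (1 : A), DifferentiableAt ℝ ψ x := by
    filter_upwards [hψc.eventually (by simp)] with x hx
    exact hx.differentiableAt one_ne_zero
  have hsm : ∀ᶠ x in 𝓝 (1 : A), ‖ψ x‖ < η := by
    have : Tendsto (fun x => ‖ψ x‖) (𝓝 1) (𝓝 0) := by
      have := hψc.continuousAt.norm
      unfold ContinuousAt at this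
      simpa only [hψ1, norm_zero] using this
    exact this.eventually (gt_mem_nhds hη)
  obtain ⟨ρ, hρ, hball⟩ := Metric.eventually_nhds_iff_ball.1 (hright.and (hdiff.and hsm))
  have hcont : Continuous fun q : A × A => exp q.1 * exp q.2 :=
    (continuous_exp_real.comp continuous_fst).mul (continuous_exp_real.comp continuous_snd)
  have hnear : ∀ᶠ q in 𝓝 (0 : A × A), exp q.1 * exp q.2 ∈ Metric.ball (1 : A) ρ := by
    refine hcont.continuousAt.eventually_mem ?_
    simpa [exp_zero] using Metric.ball_mem_nhds (1 : A) hρ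
  obtain ⟨δ₁, hδ₁, hδ₁b⟩ := Metric.eventually_nhds_iff_ball.1 hnear
  obtain ⟨δ₂, hδ₂, hδ₂b⟩ := Metric.eventually_nhds_iff_ball.1 hleft
  -- `δ₁` keeps the path `f` in the domain of the chart, and `δ₂` ensures that it starts at the
  -- coordinates `(Y, 0)`.
  refine ⟨min δ₁ δ₂ / 2, by positivity, fun X hX hXn Y hY hYn => ?_⟩
  have hlt : min δ₁ δ₂ / 2 < min δ₁ δ₂ := half_lt_self (lt_min hδ₁ hδ₂)
  -- This path joins `exp Y` to `exp X * exp Y` and solves `f' = X f`, so its `C`-coordinate stays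
  -- constant, equal to `0`.
  set f : ℝ → A := fun t => exp (t • X) * exp Y
  have hfb : ∀ t ∈ Icc (0 : ℝ) 1, f t ∈ Metric.ball (1 : A) ρ := by
    intro t ht
    refine hδ₁b (t • X, Y) ?_
    rw [mem_ball_zero_iff, Prod.norm_def]
    refine max_lt ?_ ((hYn.trans_lt hlt).trans_le (min_le_left _ _))
    refine lt_of_le_of_lt ?_ ((hXn.trans_lt hlt).trans_le (min_le_left _ _))
    rw [norm_smul, Real.norm_of_nonneg ht.1]
    exact mul_le_of_le_one_left (norm_nonneg _) ht.2
  have hf' : ∀ t, HasDerivAt f (X * f t) t := fun t => by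
    have := (hasDerivAt_exp_smul_const' (𝕂 := ℝ) X t).mul_const (exp Y)
    rwa [mul_assoc] at this
  set p : ℝ → 𝔥 × C := fun t => ψ (f t)
  have hp : ∀ t ∈ Icc (0 : ℝ) 1, ∃ p', HasDerivAt p p' t ∧ p'.2 = 0 := by
    intro t ht
    obtain ⟨h1, h2, h3⟩ := hball _ (hfb t ht)
    have hpd : HasDerivAt p (fderiv ℝ ψ (f t) (X * f t)) t :=
      h2.hasFDerivAt.comp_hasDerivAt t (hf' t)
    set p' := fderiv ℝ ψ (f t) (X * f t)
    refine ⟨p', hpd, ?_⟩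
    have hp1 : HasDerivAt (fun t => ((p t).1 : A)) (p'.1 : A) t :=
      (𝔥.subtypeL.comp (ContinuousLinearMap.fst ℝ 𝔥 C)).hasFDerivAt.comp_hasDerivAt t hpd
    have hp2 : HasDerivAt (fun t => ((p t).2 : A)) (p'.2 : A) t :=
      (C.subtypeL.comp (ContinuousLinearMap.snd ℝ 𝔥 C)).hasFDerivAt.comp_hasDerivAt t hpd
    have hexp : HasDerivAt (fun t => exp ((p t).1 : A)) (fderiv ℝ exp ((p t).1 : A) p'.1) t :=
      HasFDerivAt.comp_hasDerivAt t
        (contDiff_exp_real.differentiable (by simp) ((p t).1 : A)).hasFDerivAt hp1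
    have hcomp := hexp.mul (hp2.const_add 1)
    have hfeq : f =ᶠ[𝓝 t] (fun t => exp ((p t).1 : A)) * fun t => 1 + ((p t).2 : A) := by
      have : ∀ᶠ s in 𝓝 t, f s ∈ Metric.ball (1 : A) ρ :=
        (hf' t).continuousAt.eventually_mem (Metric.isOpen_ball.mem_nhds (hfb t ht))
      filter_upwards [this] with s hs
      exact (hball _ hs).1.symm
    have huniq := (hcomp.congr_of_eventuallyEq hfeq).unique (hf' t)
    have hft : f t = exp ((p t).1 : A) * (1 + ((p t).2 : A)) := h1.symm
    rw [hft] at huniq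
    refine Subtype.ext (deriv_complement_eq_zero h𝔥 π hπ hπC hX (p t).1.2 p'.1.2 p'.2.2 ?_ huniq)
    have hle : ‖((p t).2 : A)‖ ≤ 1 / (‖π‖ + 1) :=
      ((norm_snd_le (p t)).trans h3.le).trans (min_le_right _ _)
    calc ‖π‖ * ‖((p t).2 : A)‖ ≤ ‖π‖ * (1 / (‖π‖ + 1)) := by gcongr
      _ < 1 := by rw [mul_one_div, div_lt_one (by positivity)]; linarith
  have hconst : (p 1).2 = (p 0).2 := by
    refine constant_of_has_deriv_right_zero (f := fun t => (p t).2) (a := 0) (b := 1) ?_ ?_ 1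
      (by simp)
    · intro t ht
      obtain ⟨p', h, -⟩ := hp t ht
      exact (h.continuousAt.snd).continuousWithinAt
    · intro t ht
      obtain ⟨p', h, h0⟩ := hp t (Ico_subset_Icc_self ht)
      have := (ContinuousLinearMap.snd ℝ 𝔥 C).hasFDerivAt.comp_hasDerivAt t h
      rw [ContinuousLinearMap.coe_snd', h0] at this
      exact this.hasDerivWithinAt
  have hp0 : (p 0).2 = 0 := by
    have : ψ (Φ (⟨Y, hY⟩, 0)) = (⟨Y, hY⟩, 0) := by
      refine hδ₂b _ ?_
      rw [mem_ball_zero_iff, Prod.norm_def]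
      refine max_lt ((hYn.trans_lt hlt).trans_le (min_le_right _ _)) ?_
      simpa using hδ₂
    have h0 : p 0 = (⟨Y, hY⟩, 0) := by
      rw [← this]; simp [p, f, Φ, exp_zero]
    rw [h0]
  obtain ⟨h1, h2, h3⟩ := hball _ (hfb 1 (by simp))
  refine ⟨(p 1).1, (p 1).1.2, ((norm_fst_le (p 1)).trans h3.le).trans (min_le_left _ _), ?_⟩
  have : f 1 = exp ((p 1).1 : A) * (1 + ((p 1).2 : A)) := h1.symm
  rw [hconst, hp0] at this
  simpa [f] using this

end LocalGroup

/-! ### Countable covers of immersed Lie subgroups -/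

section Cover

variable {A : Type*} [NormedRing A] [NormedAlgebra ℝ A] [FiniteDimensional ℝ A]

/-- The subgroup generated by the exponentials of a Lie subalgebra is covered by countably many
translates of exponentials of small elements. -/
theorem exists_countable_cover_closure_exp {𝔥 : Submodule ℝ A}
    (h𝔥 : ∀ X ∈ 𝔥, ∀ Y ∈ 𝔥, X * Y - Y * X ∈ 𝔥) {ε : ℝ} (hε : 0 < ε) :
    ∃ D : Set Aˣ, D.Countable ∧ D ⊆ Subgroup.closure {g : Aˣ | ∃ Y ∈ 𝔥, (g : A) = exp Y} ∧
      ∀ h ∈ Subgroup.closure {g : Aˣ | ∃ Y ∈ 𝔥, (g : A) = exp Y},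
        ∃ d ∈ D, ∃ Z ∈ 𝔥, ‖Z‖ ≤ ε ∧ (h : A) = exp Z * d := by
  have _ : CompleteSpace A := FiniteDimensional.complete ℝ A
  obtain ⟨r₀, hr₀, hinj⟩ := exists_injOn_exp_ball (A := A)
  obtain ⟨δ₁, hδ₁, hlaw₁⟩ := exists_exp_mul_exp_eq_exp h𝔥 (half_pos hr₀)
  obtain ⟨δ₂, hδ₂, hlaw₂⟩ := exists_exp_mul_exp_eq_exp h𝔥 (half_pos hδ₁)
  set r := min δ₂ (min ε (r₀ / 2))
  have hr : 0 < r := by positivity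
  obtain ⟨D₀, hD₀c, hD₀d⟩ := TopologicalSpace.exists_countable_dense 𝔥
  have _ : Countable D₀ := hD₀c.to_subtype
  have hmem : ∀ q ∈ 𝔥, expUnit q ∈ Subgroup.closure {g : Aˣ | ∃ Y ∈ 𝔥, (g : A) = exp Y} :=
    fun q hq => Subgroup.subset_closure ⟨q, hq, rfl⟩
  -- The translates are finite products of exponentials from a countable dense subset of `𝔥`.
  let pr : List D₀ → Aˣ := fun l => (l.map fun q => expUnit ((q : 𝔥) : A)).prod
  have hstep : ∀ Y ∈ 𝔥, ‖Y‖ ≤ r → ∀ x : Aˣ, (∃ l, ∃ Z ∈ 𝔥, ‖Z‖ ≤ r ∧ (x : A) = exp Z * pr l) →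
      ∃ l, ∃ Z ∈ 𝔥, ‖Z‖ ≤ r ∧ exp Y * (x : A) = exp Z * pr l := by
    rintro Y hY hYr x ⟨l, Z, hZ, hZr, hx⟩
    obtain ⟨Z₃, hZ₃, hZ₃n, hZ₃e⟩ :=
      hlaw₂ Y hY (hYr.trans (min_le_left _ _)) Z hZ (hZr.trans (min_le_left _ _))
    have hcont : Continuous fun q : 𝔥 => exp Z₃ * exp (-(q : A)) :=
      continuous_const.mul (continuous_exp_real.comp continuous_subtype_val.neg)
    have hU : ∀ᶠ q : 𝔥 in 𝓝 ⟨Z₃, hZ₃⟩,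
        exp Z₃ * exp (-(q : A)) ∈ exp '' Metric.ball (0 : A) r ∧ ‖(q : A)‖ < δ₁ := by
      refine Filter.Eventually.and (hcont.continuousAt.eventually_mem ?_) ?_
      · simpa [exp_mul_exp_neg] using exp_image_ball_mem_nhds hr
      · refine (continuous_subtype_val.norm.continuousAt).eventually_lt continuousAt_const ?_
        exact hZ₃n.trans_lt (half_lt_self hδ₁)
    -- Approximate `Z₃` by `q` in the dense set: the error `exp Z₃ * exp (-q)` has a logarithm `Z₅`
    -- of norm below `r` and, by the local law, a logarithm `Z₄` in `𝔥`. Injectivity of `exp` near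
    -- `0` identifies them.
    obtain ⟨q, ⟨⟨Z₅, hZ₅, hZ₅e⟩, hqn⟩, hqD⟩ := mem_closure_iff_nhds.1 (hD₀d _) _ hU
    obtain ⟨Z₄, hZ₄, hZ₄n, hZ₄e⟩ := hlaw₁ Z₃ hZ₃ (hZ₃n.trans (half_le_self hδ₁.le)) (-(q : A))
      (𝔥.neg_mem q.2) (by rw [norm_neg]; exact hqn.le)
    rw [mem_ball_zero_iff] at hZ₅
    have h45 : Z₄ = Z₅ := by
      refine hinj ?_ ?_ (hZ₄e.symm.trans hZ₅e.symm)
      · rw [mem_ball_zero_iff]; exact hZ₄n.trans_lt (half_lt_self hr₀)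
      · rw [mem_ball_zero_iff]
        exact hZ₅.trans (((min_le_right _ _).trans (min_le_right _ _)).trans_lt (half_lt_self hr₀))
    refine ⟨⟨q, hqD⟩ :: l, Z₄, hZ₄, h45 ▸ hZ₅.le, ?_⟩
    have hpr : ((pr (⟨q, hqD⟩ :: l) : Aˣ) : A) = exp (q : A) * pr l := by
      simp [pr, expUnit]
    rw [hpr, ← hZ₄e, hx, ← mul_assoc, hZ₃e]
    calc exp Z₃ * (pr l : A) = exp Z₃ * (exp (-(q : A)) * exp (q : A)) * pr l := by
          rw [exp_neg_mul_exp, mul_one]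
      _ = _ := by simp only [mul_assoc]
  have hmul : ∀ Y ∈ 𝔥, ∀ x : Aˣ, (∃ l, ∃ Z ∈ 𝔥, ‖Z‖ ≤ r ∧ (x : A) = exp Z * pr l) →
      ∃ l, ∃ Z ∈ 𝔥, ‖Z‖ ≤ r ∧ exp Y * (x : A) = exp Z * pr l := by
    intro Y hY x hx
    -- Split `exp Y` into `n` factors `exp (Y/n)` short enough for `hstep`.
    obtain ⟨n, hn⟩ := exists_nat_gt (‖Y‖ / r)
    have hn0 : 0 < (n : ℝ) := (by positivity : 0 ≤ ‖Y‖ / r).trans_lt hn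
    set y := (n : ℝ)⁻¹ • Y
    have hy : y ∈ 𝔥 := 𝔥.smul_mem _ hY
    have hyr : ‖y‖ ≤ r := by
      rw [norm_smul, norm_inv, Real.norm_of_nonneg hn0.le, inv_mul_le_iff₀ hn0]
      rw [div_lt_iff₀ hr] at hn
      exact hn.le
    have hpow : ∀ k : ℕ, ∃ l, ∃ Z ∈ 𝔥, ‖Z‖ ≤ r ∧ ((expUnit y ^ k * x : Aˣ) : A) = exp Z * pr l := by
      intro k
      induction k with
      | zero => simpa using hx
      | succ k ih =>
        have := hstep y hy hyr _ ih
        rwa [pow_succ', mul_assoc, Units.val_mul]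
    have hYy : exp Y = exp y ^ n := by
      rw [← exp_nsmul_real, ← Nat.cast_smul_eq_nsmul ℝ, smul_smul, mul_inv_cancel₀ hn0.ne', one_smul]
    have := hpow n
    rwa [Units.val_mul, Units.val_pow_eq_pow_val, show ((expUnit y : Aˣ) : A) = exp y from rfl,
      ← hYy] at this
  refine ⟨range pr, countable_range _, ?_, fun h hh => ?_⟩
  · rintro _ ⟨l, rfl⟩
    refine Subgroup.list_prod_mem _ fun x hx => ?_
    obtain ⟨q, -, rfl⟩ := List.mem_map.1 hx
    exact hmem _ (q : 𝔥).2
  · have key : ∃ l, ∃ Z ∈ 𝔥, ‖Z‖ ≤ r ∧ (h : A) = exp Z * pr l := by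
      induction hh using Subgroup.closure_induction_left with
      | one => exact ⟨[], 0, 𝔥.zero_mem, by simpa using hr.le, by simp [pr, exp_zero]⟩
      | mul_left x hx y hy ih =>
        obtain ⟨Y, hY, hxY⟩ := hx
        rw [Units.val_mul, hxY]
        exact hmul Y hY y ih
      | inv_mul_cancel x hx y hy ih =>
        obtain ⟨Y, hY, hxY⟩ := hx
        have : x = expUnit Y := Units.ext hxY
        rw [Units.val_mul, this]
        exact hmul (-Y) (𝔥.neg_mem hY) y ih
    obtain ⟨l, Z, hZ, hZr, hh⟩ := key
    exact ⟨pr l, mem_range_self l, Z, hZ,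
      hZr.trans ((min_le_right _ _).trans (min_le_left _ _)), hh⟩

end Cover

/-! ### Connected groups and a Steinhaus property -/

section Haar

variable {G : Type*} [Group G] [TopologicalSpace G] [IsTopologicalGroup G]

theorem Subgroup.eq_top_of_mem_nhds_one [ConnectedSpace G] (K : Subgroup G)
    (h : (K : Set G) ∈ 𝓝 1) : K = ⊤ := by
  have ho : IsOpen (K : Set G) := K.isOpen_of_mem_nhds h
  have hc : IsClopen (K : Set G) := ⟨K.isClosed_of_isOpen ho, ho⟩
  exact SetLike.coe_injective (by simpa using hc.eq_univ ⟨1, K.one_mem⟩)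

variable [LocallyCompactSpace G] [SecondCountableTopology G] [T2Space G]
  [MeasurableSpace G] [BorelSpace G]

open Pointwise in
/-- Steinhaus: a set of positive Haar measure meets its small translates in positive measure. -/
theorem eventually_measure_inter_smul_pos (m : Measure G) [m.IsHaarMeasure] {S : Set G}
    (hS : MeasurableSet S) (hm : 0 < m S) : ∀ᶠ u in 𝓝 (1 : G), 0 < m (S ∩ u • S) := by
  obtain ⟨K, hKS, hK, hKm⟩ := hS.exists_lt_isCompact hm
  filter_upwards [eventually_nhds_one_measure_smul_sdiff_lt hK hK.isClosed hKm.ne' (μ := m)]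
    with u hu
  have h1 : m (u • K) ≤ m (u • K ∩ K) + m (u • K \ K) := by
    conv_lhs => rw [← inter_union_sdiff (u • K) K]
    exact measure_union_le _ _
  rw [measure_smul] at h1
  have h2 : 0 < m (u • K ∩ K) := by
    by_contra h0
    rw [not_lt, nonpos_iff_eq_zero] at h0
    rw [h0, zero_add] at h1
    exact absurd hu h1.not_gt
  refine h2.trans_le (measure_mono fun x hx => ⟨hKS hx.2, smul_set_mono hKS hx.1⟩)

end Haar

/-! ### Conjugation into a subgroup with finite core -/

section Conjugation

variable {A : Type*} [NormedRing A] [NormedAlgebra ℝ A]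
variable {G : Type*} [Group G]

/-- Conjugation by the image of `g` in the units, as a linear map. -/
noncomputable def conjL (ι : G →* Aˣ) (g : G) : A →ₗ[ℝ] A :=
  LinearMap.mulRight ℝ ((ι g⁻¹ : Aˣ) : A) ∘ₗ LinearMap.mulLeft ℝ ((ι g : Aˣ) : A)

theorem conjL_apply (ι : G →* Aˣ) (g : G) (X : A) :
    conjL ι g X = (ι g : A) * X * (ι g⁻¹ : Aˣ) := rfl

theorem conjL_mul (ι : G →* Aˣ) (g h : G) (X : A) :
    conjL ι (g * h) X = conjL ι g (conjL ι h X) := by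
  simp only [conjL_apply, mul_inv_rev, map_mul, Units.val_mul, mul_assoc]

theorem conjL_one (ι : G →* Aˣ) (X : A) : conjL ι 1 X = X := by
  simp [conjL_apply]

theorem conjL_inv_conjL (ι : G →* Aˣ) (g : G) (X : A) : conjL ι g⁻¹ (conjL ι g X) = X := by
  rw [← conjL_mul, inv_mul_cancel, conjL_one]

theorem continuous_conjL_inv [TopologicalSpace G] [IsTopologicalGroup G] (ι : G →* Aˣ) (hι : Continuous ι)
    (X : A) :
    Continuous fun g => conjL ι g⁻¹ X := by
  simp only [conjL_apply, inv_inv]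
  have h1 : Continuous fun g : G => ((ι g : Aˣ) : A) := Units.continuous_val.comp hι
  exact ((h1.comp continuous_inv).mul continuous_const).mul h1

variable [FiniteDimensional ℝ A]

theorem exp_conjL (ι : G →* Aˣ) (g : G) (X : A) :
    exp (conjL ι g X) = (ι g : A) * exp X * (ι g⁻¹ : Aˣ) := by
  have _ : CompleteSpace A := FiniteDimensional.complete ℝ A
  rw [conjL_apply, map_inv, exp_units_conj_real]

/-- A conjugation-invariant subspace of the Lie algebra of a group with finite normal core is
zero. -/
theorem eq_zero_of_mem_invariant_submodule (ι : G →* Aˣ) (hinj : Function.Injective ι)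
    {𝔥 : Submodule ℝ A} {H : Subgroup G}
    (hH : H.map ι = Subgroup.closure {g : Aˣ | ∃ Y ∈ 𝔥, (g : A) = exp Y})
    (hcore : {h : G | ∀ g : G, g * h * g⁻¹ ∈ H}.Finite)
    {E : Submodule ℝ A} (hE : E ≤ 𝔥) (hinv : ∀ g, ∀ X ∈ E, conjL ι g X ∈ E) {L : A} (hL : L ∈ E) :
    L = 0 := by
  have _ : CompleteSpace A := FiniteDimensional.complete ℝ A
  have hmemH : ∀ X ∈ E, ∃ h ∈ H, ι h = expUnit X := fun X hX => by
    have : expUnit X ∈ H.map ι := by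
      rw [hH]; exact Subgroup.subset_closure ⟨X, hE hX, rfl⟩
    exact this
  have hcoreE : ∀ X ∈ E, exp X ∈ (fun h => (ι h : A)) '' {h : G | ∀ g : G, g * h * g⁻¹ ∈ H} := by
    intro X hX
    obtain ⟨h, hh, hhX⟩ := hmemH X hX
    refine ⟨h, fun g => ?_, by simp only [hhX]; rfl⟩
    obtain ⟨h', hh', hhX'⟩ := hmemH _ (hinv g X hX)
    have : g * h * g⁻¹ = h' := hinj (Units.ext (by
      rw [hhX', map_mul, map_mul, hhX]
      exact (exp_conjL ι g X).symm))
    rwa [this]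
  by_contra hne
  have hpos : 0 < ‖L‖ := norm_pos_iff.2 hne
  obtain ⟨r, hr, hrinj⟩ := exists_injOn_exp_ball (A := A)
  -- Infinitely many short multiples of `L` have distinct exponentials, all in the finite core.
  have hinf : (Ioo 0 (r / ‖L‖)).Infinite := Ioo_infinite (by positivity)
  refine infinite_of_injOn_mapsTo (f := fun t : ℝ => exp (t • L)) ?_
    (fun t _ => hcoreE _ (E.smul_mem t hL)) hinf (hcore.image _)
  · intro s hs t ht hst
    have hb : ∀ t ∈ Ioo 0 (r / ‖L‖), t • L ∈ Metric.ball (0 : A) r := fun t ht => by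
      rw [mem_ball_zero_iff, norm_smul, Real.norm_of_nonneg ht.1.le]
      exact (lt_div_iff₀ hpos).1 ht.2
    exact smul_left_injective ℝ hne (hrinj (hb s hs) (hb t ht) hst)

variable [TopologicalSpace G] [IsTopologicalGroup G] [ConnectedSpace G] [LocallyCompactSpace G]
  [SecondCountableTopology G] [T2Space G] [MeasurableSpace G] [BorelSpace G]

/-- If `g⁻¹ L g ∈ V` for a set of `g` of positive Haar measure, then `L` lies in a
conjugation-invariant subspace of `V`. -/
theorem exists_invariant_submodule (ι : G →* Aˣ) (hι : Continuous ι) (m : Measure G)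
    [m.IsHaarMeasure] (V : Submodule ℝ A) (L : A) (hL : 0 < m {g | conjL ι g⁻¹ L ∈ V}) :
    ∃ E : Submodule ℝ A, L ∈ E ∧ E ≤ V ∧ ∀ g, ∀ X ∈ E, conjL ι g X ∈ E := by
  let F : Submodule ℝ A → Set G := fun E => {g | ∀ X ∈ E, conjL ι g⁻¹ X ∈ V}
  have hVc : IsClosed (V : Set A) := V.closed_of_finiteDimensional
  have hFc : ∀ E, IsClosed (F E) := fun E => by
    have : F E = ⋂ X ∈ E, (fun g => conjL ι g⁻¹ X) ⁻¹' (V : Set A) := by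
      ext g; simp [F]
    rw [this]
    exact isClosed_biInter fun X _ => hVc.preimage (continuous_conjL_inv ι hι X)
  have hne : ({E | L ∈ E ∧ 0 < m (F E)} : Set (Submodule ℝ A)).Nonempty := by
    refine ⟨Submodule.span ℝ {L}, Submodule.mem_span_singleton_self L, hL.trans_le ?_⟩
    refine measure_mono fun g hg X hX => ?_
    obtain ⟨c, rfl⟩ := Submodule.mem_span_singleton.1 hX
    rw [map_smul]
    exact V.smul_mem c hg
  -- Take `E` maximal among subspaces containing `L` and sent into `V` by a positive-measure set of
  -- `g`. For `u` near `1`, every `g ∈ F E ∩ u • F E` also sends `E + Ad(u)E` into `V`, so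
  -- maximality gives `Ad(u)E ≤ E`.
  obtain ⟨E, ⟨hLE, hEm⟩, hmax⟩ :=
    (wellFounded_gt (α := Submodule ℝ A)).has_min _ hne
  have hst : ∀ᶠ u in 𝓝 (1 : G), ∀ X ∈ E, conjL ι u X ∈ E := by
    filter_upwards [eventually_measure_inter_smul_pos m (hFc E).measurableSet hEm] with u hu
    have hle : E ≤ E ⊔ E.map (conjL ι u) := le_sup_left
    have hmem : L ∈ E ⊔ E.map (conjL ι u) ∧ 0 < m (F (E ⊔ E.map (conjL ι u))) := by
      refine ⟨hle hLE, hu.trans_le (measure_mono ?_)⟩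
      rintro g ⟨hg, h, hh, rfl⟩ X hX
      obtain ⟨Y, hY, W, hW, rfl⟩ := Submodule.mem_sup.1 hX
      obtain ⟨Z, hZ, rfl⟩ := hW
      rw [map_add]
      refine V.add_mem (hg Y hY) ?_
      change conjL ι (u * h)⁻¹ (conjL ι u Z) ∈ V
      rw [mul_inv_rev, conjL_mul, conjL_inv_conjL]
      exact hh Z hZ
    have heq : E = E ⊔ E.map (conjL ι u) :=
      hle.eq_of_not_lt (hmax _ hmem)
    intro X hX
    rw [heq]
    exact Submodule.mem_sup_right (Submodule.mem_map_of_mem hX)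
  let K : Subgroup G :=
    { carrier := {u | (∀ X ∈ E, conjL ι u X ∈ E) ∧ ∀ X ∈ E, conjL ι u⁻¹ X ∈ E}
      mul_mem' := fun {a b} ha hb => ⟨fun X hX => by
        rw [conjL_mul]; exact ha.1 _ (hb.1 X hX), fun X hX => by
        rw [mul_inv_rev, conjL_mul]; exact hb.2 _ (ha.2 X hX)⟩
      one_mem' := ⟨fun X hX => by rwa [conjL_one], fun X hX => by rwa [inv_one, conjL_one]⟩
      inv_mem' := fun {a} ha => ⟨ha.2, by rw [inv_inv]; exact ha.1⟩ }
  have hK : K = ⊤ := by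
    refine K.eq_top_of_mem_nhds_one ?_
    have hinv : Tendsto (fun u : G => u⁻¹) (𝓝 1) (𝓝 1) := by
      simpa using (continuous_inv (G := G)).tendsto 1
    exact hst.and (hinv.eventually hst)
  have hinvE : ∀ g, ∀ X ∈ E, conjL ι g X ∈ E := fun g => by
    have : g ∈ K := hK ▸ Subgroup.mem_top g
    exact this.1
  refine ⟨E, hLE, fun X hX => ?_, hinvE⟩
  obtain ⟨g, hg⟩ := nonempty_of_measure_ne_zero hEm.ne'
  have := hg _ (hinvE g X hX)
  rwa [conjL_inv_conjL] at this

/-- If an element is conjugated into an immersed Lie subgroup `H` with finite normal core by a set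
of positive Haar measure, then it lies in the normal core of `H`. -/
theorem conj_mem_of_measure_pos (ι : G →* Aˣ) (hι : Continuous ι) (hinj : Function.Injective ι)
    {𝔥 : Submodule ℝ A} (h𝔥 : ∀ X ∈ 𝔥, ∀ Y ∈ 𝔥, X * Y - Y * X ∈ 𝔥) {H : Subgroup G}
    (hH : H.map ι = Subgroup.closure {g : Aˣ | ∃ Y ∈ 𝔥, (g : A) = exp Y})
    (hcore : {h : G | ∀ g : G, g * h * g⁻¹ ∈ H}.Finite) (m : Measure G) [m.IsHaarMeasure]
    {γ : G} (hγ : m {g | g⁻¹ * γ * g ∈ H} ≠ 0) (g : G) : g * γ * g⁻¹ ∈ H := by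
  have _ : CompleteSpace A := FiniteDimensional.complete ℝ A
  have _ : ProperSpace A := FiniteDimensional.proper ℝ A
  have hιA : Continuous fun g : G => ((ι g : Aˣ) : A) := Units.continuous_val.comp hι
  obtain ⟨r₀, hr₀, hexp⟩ := exists_injOn_exp_ball (A := A)
  obtain ⟨δ, hδ, hlaw⟩ := exists_exp_mul_exp_eq_exp h𝔥 (half_pos hr₀)
  obtain ⟨D, hD, -, hcov⟩ := exists_countable_cover_closure_exp h𝔥 hδ
  have _ : Countable D := hD.to_subtype
  -- The norm bounds on `g` and `g⁻¹` make the later estimate of `g⁻¹Lg` uniform on each piece.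
  let T : ℕ × D → Set G := fun p => {g | ‖(ι g : A)‖ ≤ p.1 ∧ ‖((ι g⁻¹ : Aˣ) : A)‖ ≤ p.1 ∧
    ∃ Z ∈ 𝔥, ‖Z‖ ≤ δ ∧ (ι (g⁻¹ * γ * g) : A) = exp Z * ((p.2 : Aˣ) : A)}
  have hTc : ∀ p, IsClosed (T p) := by
    intro p
    refine (isClosed_le hιA.norm continuous_const).inter
      ((isClosed_le (hιA.comp continuous_inv).norm continuous_const).inter ?_)
    have hcomp : IsCompact ((𝔥 : Set A) ∩ Metric.closedBall 0 δ) :=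
      (isCompact_closedBall (0 : A) δ).inter_left 𝔥.closed_of_finiteDimensional
    have hcl : IsClosed ((fun Z => exp Z * ((p.2 : Aˣ) : A)) '' ((𝔥 : Set A) ∩ Metric.closedBall 0 δ)) :=
      (hcomp.image (continuous_exp_real.mul continuous_const)).isClosed
    have hcont : Continuous fun g : G => (ι (g⁻¹ * γ * g) : A) := hιA.comp (by fun_prop)
    have heq : {g : G | ∃ Z ∈ 𝔥, ‖Z‖ ≤ δ ∧ (ι (g⁻¹ * γ * g) : A) = exp Z * ((p.2 : Aˣ) : A)} =
        (fun g : G => (ι (g⁻¹ * γ * g) : A)) ⁻¹' ((fun Z => exp Z * ((p.2 : Aˣ) : A)) ''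
          ((𝔥 : Set A) ∩ Metric.closedBall 0 δ)) := by
      ext g
      simp only [mem_ofPred_eq, mem_preimage, mem_image, mem_inter_iff, SetLike.mem_coe,
        mem_closedBall_zero_iff, and_assoc, eq_comm]
    have h3 := hcl.preimage hcont
    rw [← heq] at h3
    exact h3
  have hsub : {g | g⁻¹ * γ * g ∈ H} ⊆ ⋃ p, T p := by
    intro g hg
    have hg' : ι (g⁻¹ * γ * g) ∈ H.map ι := Subgroup.mem_map_of_mem ι hg
    rw [hH] at hg'
    obtain ⟨d, hd, Z, hZ, hZn, hZe⟩ := hcov _ hg'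
    obtain ⟨n, hn⟩ := exists_nat_ge (max ‖(ι g : A)‖ ‖((ι g⁻¹ : Aˣ) : A)‖)
    exact mem_iUnion.2 ⟨(n, ⟨d, hd⟩), (le_max_left _ _).trans hn, (le_max_right _ _).trans hn,
      Z, hZ, hZn, hZe⟩
  obtain ⟨p, hp⟩ : ∃ p, 0 < m (T p) := by
    by_contra! h
    refine hγ (measure_mono_null hsub (measure_iUnion_null fun p => ?_))
    exact nonpos_iff_eq_zero.1 (h p)
  set r₁ := r₀ / ((p.1 : ℝ) * p.1 + 1)
  have hr₁ : 0 < r₁ := by positivity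
  have hb : ∀ᶠ u in 𝓝 (1 : G), (ι (u * γ * u⁻¹ * γ⁻¹) : A) ∈ exp '' Metric.ball (0 : A) r₁ := by
    have hcont : Continuous fun u : G => (ι (u * γ * u⁻¹ * γ⁻¹) : A) := hιA.comp (by fun_prop)
    refine hcont.continuousAt.eventually_mem ?_
    simpa using exp_image_ball_mem_nhds hr₁
  have hcentral : ∀ᶠ u in 𝓝 (1 : G), u ∈ Subgroup.centralizer {γ} := by
    filter_upwards [hb, eventually_measure_inter_smul_pos m (hTc p).measurableSet hp]
      with u ⟨L, hLr, hL⟩ hu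
    rw [mem_ball_zero_iff] at hLr
    have hpos : 0 < m {g | conjL ι g⁻¹ L ∈ 𝔥} := by
      refine hu.trans_le (measure_mono ?_)
      rintro _ ⟨⟨hn₁, hn₂, Z, hZ, hZn, hZe⟩, h, ⟨-, -, Z', hZ', hZn', hZe'⟩, rfl⟩
      simp only [smul_eq_mul] at hn₁ hn₂ hZe ⊢
      set g := u * h
      obtain ⟨Z₃, hZ₃, hZ₃n, hZ₃e⟩ := hlaw Z' hZ' hZn' (-Z) (𝔥.neg_mem hZ) (by rwa [norm_neg])
      -- With `g = uh`, the product `(h⁻¹γh)(g⁻¹γg)⁻¹` is `g⁻¹(uγu⁻¹γ⁻¹)g`, and the common factor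
      -- `p.2` cancels.
      have hconj : exp (conjL ι g⁻¹ L) = exp Z₃ := by
        have h1 : exp Z' = ι (h⁻¹ * γ * h) * ((p.2⁻¹ : Aˣ) : A) := by
          rw [hZe', mul_assoc, Units.mul_inv, mul_one]
        have h2 : exp (-Z) = ((p.2 : Aˣ) : A) * (ι (g⁻¹ * γ * g)⁻¹ : Aˣ) := by
          have : ((ι (g⁻¹ * γ * g))) = expUnit Z * p.2 := Units.ext hZe
          rw [map_inv, this, mul_inv_rev, Units.val_mul, Units.mul_inv_cancel_left]
          rfl
        rw [exp_conjL, hL, ← hZ₃e, inv_inv, h1, h2, mul_assoc (ι (h⁻¹ * γ * h) : A),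
          Units.inv_mul_cancel_left, ← Units.val_mul, ← Units.val_mul, ← Units.val_mul,
          ← map_mul, ← map_mul, ← map_mul]
        congr 2
        simp only [g]
        group
      have hZL : conjL ι g⁻¹ L = Z₃ := by
        refine hexp ?_ ?_ hconj
        · rw [mem_ball_zero_iff, conjL_apply, inv_inv]
          calc ‖((ι g⁻¹ : Aˣ) : A) * L * (ι g : Aˣ)‖ ≤ ‖((ι g⁻¹ : Aˣ) : A)‖ * ‖L‖ * ‖(ι g : A)‖ :=
                (norm_mul_le _ _).trans (by gcongr; exact norm_mul_le _ _)
            _ ≤ p.1 * ‖L‖ * p.1 := by gcongr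
            _ = (p.1 * p.1) * ‖L‖ := by ring
            _ ≤ ((p.1 : ℝ) * p.1 + 1) * ‖L‖ := by gcongr; linarith
            _ < r₀ := by
              rw [mul_comm]
              exact (lt_div_iff₀ (by positivity)).1 hLr
        · rw [mem_ball_zero_iff]
          exact hZ₃n.trans_lt (half_lt_self hr₀)
      change conjL ι g⁻¹ L ∈ 𝔥
      rwa [hZL]
    obtain ⟨E, hLE, hE, hinv⟩ := exists_invariant_submodule ι hι m 𝔥 L hpos
    have hL0 := eq_zero_of_mem_invariant_submodule ι hinj hH hcore hE hinv hLE
    rw [hL0, exp_zero] at hL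
    have h1 : u * γ * u⁻¹ * γ⁻¹ = 1 := hinj (by rw [map_one]; exact Units.ext hL.symm)
    rw [Subgroup.mem_centralizer_singleton_iff]
    rw [mul_inv_eq_one, mul_inv_eq_iff_eq_mul] at h1
    exact h1
  have htop := (Subgroup.centralizer {γ}).eq_top_of_mem_nhds_one hcentral
  have hcomm : ∀ g : G, g * γ = γ * g := fun g =>
    Subgroup.mem_centralizer_singleton_iff.1 (htop ▸ Subgroup.mem_top g)
  obtain ⟨g₀, hg₀⟩ := nonempty_of_measure_ne_zero hγ
  rw [hcomm g, mul_inv_cancel_right]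
  have : g₀⁻¹ * γ * g₀ ∈ H := hg₀
  rwa [mul_assoc, ← hcomm, inv_mul_cancel_left] at this

end Conjugation

/-! ### Measure theory on `G ⧸ Γ` -/

section Quotient

variable {G : Type*} [Group G] [TopologicalSpace G] [IsTopologicalGroup G]

theorem QuotientGroup.t2Space_of_isClosed (Γ : Subgroup G) (hΓ : IsClosed (Γ : Set G)) :
    T2Space (G ⧸ Γ) := by
  rw [t2Space_iff_of_isOpenQuotientMap (QuotientGroup.isOpenQuotientMap_mk (N := Γ))]
  have : {q : G × G | (q.1 : G ⧸ Γ) = q.2} = (fun q : G × G => q.1⁻¹ * q.2) ⁻¹' (Γ : Set G) := by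
    ext q; exact QuotientGroup.eq
  exact this ▸ hΓ.preimage (by fun_prop)

variable [LocallyCompactSpace G] [SecondCountableTopology G]

/-- The image in `G ⧸ Γ` of a countable union of closed sets is Borel. -/
theorem measurableSet_of_preimage_eq_iUnion_isClosed {Γ : Subgroup G}
    (hΓ : IsClosed (Γ : Set G)) [MeasurableSpace (G ⧸ Γ)] [BorelSpace (G ⧸ Γ)]
    {κ : Type*} [Countable κ] {T : κ → Set G} (hT : ∀ i, IsClosed (T i)) {E : Set (G ⧸ Γ)}
    (hE : (fun g : G => (g : G ⧸ Γ)) ⁻¹' E = ⋃ i, T i) : MeasurableSet E := by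
  have _ : T2Space (G ⧸ Γ) := QuotientGroup.t2Space_of_isClosed Γ hΓ
  -- Intersecting with a compact exhaustion makes each image compact, hence closed in the Hausdorff
  -- quotient.
  have hEi : E = ⋃ i, ⋃ n, (fun g : G => (g : G ⧸ Γ)) '' (T i ∩ compactCovering G n) := by
    rw [← image_preimage_eq E QuotientGroup.mk_surjective, hE]
    simp_rw [← image_iUnion, ← inter_iUnion, iUnion_compactCovering, inter_univ]
  rw [hEi]
  exact MeasurableSet.iUnion fun i => MeasurableSet.iUnion fun n =>
    (((isCompact_compactCovering G n).inter_left (hT i)).image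
      QuotientGroup.continuous_mk).isClosed.measurableSet

/-- A Borel set of `G ⧸ Γ` whose preimage in `G` is null for Haar measure is null for any
invariant probability measure. -/
theorem measure_eq_zero_of_preimage_haar_null [MeasurableSpace G] [BorelSpace G] {Γ : Subgroup G}
    [MeasurableSpace (G ⧸ Γ)] [BorelSpace (G ⧸ Γ)] {μ : Measure (G ⧸ Γ)}
    (hμ : IsInvariantProbability Γ μ) (m : Measure G) [m.IsHaarMeasure] {E : Set (G ⧸ Γ)}
    (hE : MeasurableSet E) (h0 : m ((fun g : G => (g : G ⧸ Γ)) ⁻¹' E) = 0) : μ E = 0 := by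
  have _ := hμ.prob
  have _ := hμ.invariant
  have hmeas : MeasurableSet {q : (G ⧸ Γ) × G | q.2 • q.1 ∉ E} :=
    ((continuous_snd.smul continuous_fst).measurable hE).compl
  -- For `x = aΓ` the set `{g | g • x ∈ E}` is a right translate of the preimage of `E`, and right
  -- translation preserves Haar-null sets. Fubini then gives one `g` with `μ (g⁻¹E) = 0`, and
  -- invariance concludes.
  have h1 : ∀ᵐ x ∂μ, ∀ᵐ g ∂m, g • x ∉ E := by
    refine Eventually.of_forall fun x => ?_
    obtain ⟨a, rfl⟩ := QuotientGroup.mk_surjective x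
    rw [ae_iff]
    simp only [not_not]
    exact (measure_mul_right_null m a).2 h0
  have h2 := (Measure.ae_ae_comm (p := fun x g => g • x ∉ E) hmeas).1 h1
  obtain ⟨g, hg⟩ := h2.exists
  rw [ae_iff] at hg
  simp only [not_not] at hg
  rwa [← measure_preimage_smul μ g E]

variable {A : Type*} [NormedRing A] [NormedAlgebra ℝ A] [FiniteDimensional ℝ A] [T2Space G]
  [ConnectedSpace G]

/-- Almost every stabiliser of the action on `G ⧸ Γ`, with `Γ` discrete and torsion-free, meets
an immersed Lie subgroup with finite normal core trivially. -/
theorem ae_stabilizer_inf_eq_bot (ι : G →* Aˣ) (hι : Continuous ι) (hinj : Function.Injective ι)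
    {𝔥 : Submodule ℝ A} (h𝔥 : ∀ X ∈ 𝔥, ∀ Y ∈ 𝔥, X * Y - Y * X ∈ 𝔥) {H : Subgroup G}
    (hH : H.map ι = Subgroup.closure {g : Aˣ | ∃ Y ∈ 𝔥, (g : A) = exp Y})
    (hcore : {h : G | ∀ g : G, g * h * g⁻¹ ∈ H}.Finite)
    (Γ : Subgroup G) [DiscreteTopology Γ] (hΓ : ∀ γ ∈ Γ, IsOfFinOrder γ → γ = 1)
    [MeasurableSpace (G ⧸ Γ)] [BorelSpace (G ⧸ Γ)] {μ : Measure (G ⧸ Γ)}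
    (hμ : IsInvariantProbability Γ μ) : ∀ᵐ x ∂μ, MulAction.stabilizer G x ⊓ H = ⊥ := by
  have _ : CompleteSpace A := FiniteDimensional.complete ℝ A
  have _ : ProperSpace A := FiniteDimensional.proper ℝ A
  have _ : Countable Γ := countable_of_Lindelof_of_discrete
  let _ : MeasurableSpace G := borel G
  have _ : BorelSpace G := ⟨rfl⟩
  let m : Measure G := Measure.haar
  have hιA : Continuous fun g : G => ((ι g : Aˣ) : A) := Units.continuous_val.comp hι
  have hpre : (fun g : G => (g : G ⧸ Γ)) ⁻¹' {x | ¬ MulAction.stabilizer G x ⊓ H = ⊥} =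
      ⋃ γ : {γ : Γ // γ ≠ 1}, {g : G | g * γ.1 * g⁻¹ ∈ H} := by
    ext g
    simp only [mem_preimage, mem_ofPred_eq, mem_iUnion, Subgroup.eq_bot_iff_forall, not_forall,
      Subgroup.mem_inf, MulAction.mem_stabilizer_iff]
    constructor
    · rintro ⟨h, ⟨hs, hh⟩, h1⟩
      have hmem : g⁻¹ * h * g ∈ Γ := by
        have : ((h * g : G) : G ⧸ Γ) = g := hs
        have := QuotientGroup.eq.1 this.symm
        rwa [← mul_assoc] at this
      refine ⟨⟨⟨_, hmem⟩, fun h' => h1 ?_⟩, ?_⟩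
      · have := Subtype.ext_iff.1 h'
        simp only [Subgroup.coe_one] at this
        rwa [mul_assoc, inv_mul_eq_one, eq_comm, mul_eq_right] at this
      · simpa [mul_assoc] using hh
    · rintro ⟨⟨⟨γ, hγ⟩, h1⟩, hh⟩
      refine ⟨g * γ * g⁻¹, ⟨?_, hh⟩, fun h' => h1 (Subtype.ext ?_)⟩
      · change ((g * γ * g⁻¹ * g : G) : G ⧸ Γ) = g
        rw [eq_comm, QuotientGroup.eq]
        simpa [mul_assoc] using hγ
      · rwa [mul_inv_eq_one, mul_eq_left] at h'
  have hnull : m ((fun g : G => (g : G ⧸ Γ)) ⁻¹' {x | ¬ MulAction.stabilizer G x ⊓ H = ⊥}) = 0 := by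
    rw [hpre]
    refine measure_iUnion_null ?_
    rintro ⟨⟨γ, hγ⟩, h1⟩
    by_contra hne
    have hpos : m {g | g⁻¹ * γ * g ∈ H} ≠ 0 := by
      have hinv : {g : G | g⁻¹ * γ * g ∈ H} = {g : G | g * γ * g⁻¹ ∈ H}⁻¹ := by
        ext g; simp
      rw [hinv]
      exact fun h => hne ((measure_inv_null m).1 h)
    have hc := conj_mem_of_measure_pos ι hι hinj h𝔥 hH hcore m hpos
    refine h1 (Subtype.ext (hΓ γ hγ ?_))
    by_contra hfin
    -- Otherwise the powers of `γ` would be infinitely many elements of the finite core.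
    have hinjp := injective_pow_iff_not_isOfFinOrder.2 hfin
    refine (infinite_range_of_injective hinjp) (hcore.subset ?_)
    rintro _ ⟨n, rfl⟩ g
    simp only [← conj_pow]
    exact H.pow_mem (hc g) n
  -- The cover is used again, for measurability: it writes the preimage of the bad set as a
  -- countable union of closed sets. The radius `1` is arbitrary, and `D ⊆ H` ensures that the
  -- pieces stay inside `H`.
  obtain ⟨D, hD, hDH, hcov⟩ := exists_countable_cover_closure_exp h𝔥 one_pos
  have _ : Countable D := hD.to_subtype
  rw [ae_iff]
  refine measure_eq_zero_of_preimage_haar_null hμ m ?_ hnull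
  let T : {γ : Γ // γ ≠ 1} × D → Set G := fun p =>
    (fun g : G => (ι (g * p.1.1 * g⁻¹) : A)) ⁻¹' ((fun Z => exp Z * ((p.2 : Aˣ) : A)) ''
      ((𝔥 : Set A) ∩ Metric.closedBall 0 1))
  refine measurableSet_of_preimage_eq_iUnion_isClosed (T := T)
    Γ.isClosed_of_discrete (fun p => ?_) ?_
  · have hcomp : IsCompact ((𝔥 : Set A) ∩ Metric.closedBall 0 1) :=
      (isCompact_closedBall (0 : A) 1).inter_left 𝔥.closed_of_finiteDimensional
    exact (hcomp.image (continuous_exp_real.mul continuous_const)).isClosed.preimage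
      (hιA.comp (by fun_prop))
  · rw [hpre, iUnion_prod']
    refine iUnion_congr fun γ => Subset.antisymm (fun g hg => ?_) (iUnion_subset fun d g hg => ?_)
    · have hg' : ι (g * γ.1 * g⁻¹) ∈ H.map ι := Subgroup.mem_map_of_mem ι hg
      rw [hH] at hg'
      obtain ⟨d, hd, Z, hZ, hZn, hZe⟩ := hcov _ hg'
      exact mem_iUnion.2 ⟨⟨d, hd⟩, Z, ⟨hZ, mem_closedBall_zero_iff.2 hZn⟩, hZe.symm⟩
    · obtain ⟨Z, ⟨hZ, -⟩, hZe⟩ := hg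
      have hmem : ι (g * γ.1 * g⁻¹) ∈ H.map ι := by
        have : ι (g * γ.1 * g⁻¹) = expUnit Z * d := Units.ext hZe.symm
        rw [this, hH]
        exact Subgroup.mul_mem _ (Subgroup.subset_closure ⟨Z, hZ, rfl⟩) (hDH d.2)
      obtain ⟨h, hh, hhe⟩ := hmem
      rw [hinj hhe] at hh
      exact hh

end Quotient

/-! ### Real points of algebraic groups and the matrix case -/

section RealPoints

variable {N : ℕ}

theorem isOpenEmbedding_generalLinearGroup_val :
    IsOpenEmbedding (fun g : GL (Fin N) ℝ => (g : Matrix (Fin N) (Fin N) ℝ)) := by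
  let _ : NormedRing (Matrix (Fin N) (Fin N) ℝ) := Matrix.linftyOpNormedRing
  let _ : NormedAlgebra ℝ (Matrix (Fin N) (Fin N) ℝ) := Matrix.linftyOpNormedAlgebra
  have _ : CompleteSpace (Matrix (Fin N) (Fin N) ℝ) := FiniteDimensional.complete ℝ _
  exact Units.isOpenEmbedding_val

/-- Real polynomial equations on real matrices are closed conditions; closedness gives local
compactness of the identity component and hence a Haar measure. -/
theorem isClosed_realPoints {GC : Subgroup (GL (Fin N) ℂ)}
    (hGC : IsZariskiClosedOver ℝ (GC : Set (GL (Fin N) ℂ))) :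
    IsClosed (realPoints GC : Set (GL (Fin N) ℝ)) := by
  obtain ⟨S, hS⟩ := hGC
  have heq : (realPoints GC : Set (GL (Fin N) ℝ)) = ⋂ p ∈ S, {g : GL (Fin N) ℝ |
      MvPolynomial.eval (fun ij : Fin N × Fin N =>
        (g : Matrix (Fin N) (Fin N) ℝ) ij.1 ij.2) p = 0} := by
    ext g
    have h1 : g ∈ (realPoints GC : Set (GL (Fin N) ℝ)) ↔
        Matrix.GeneralLinearGroup.map (algebraMap ℝ ℂ) g ∈ (GC : Set (GL (Fin N) ℂ)) := Iff.rfl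
    rw [h1, hS]
    simp only [mem_ofPred_eq, mem_iInter]
    refine forall₂_congr fun p _ => ?_
    have := MvPolynomial.aeval_algebraMap_apply (R := ℝ) ℂ (fun ij : Fin N × Fin N =>
        (g : Matrix (Fin N) (Fin N) ℝ) ij.1 ij.2) p
    change MvPolynomial.aeval (algebraMap ℝ ℂ ∘ fun ij : Fin N × Fin N =>
        (g : Matrix (Fin N) (Fin N) ℝ) ij.1 ij.2) p = 0 ↔ _
    refine (Eq.congr_left this).trans ?_
    rw [map_eq_zero_iff _ (algebraMap ℝ ℂ).injective]
    exact Iff.rfl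
  rw [heq]
  refine isClosed_biInter fun p _ => isClosed_eq ?_ continuous_const
  refine (MvPolynomial.continuous_eval p).comp (continuous_pi fun ij => ?_)
  exact Units.continuous_val.matrix_elem ij.1 ij.2

theorem isClosed_realIdentityComponent {GC : Subgroup (GL (Fin N) ℂ)}
    (hGC : IsZariskiClosedOver ℝ (GC : Set (GL (Fin N) ℂ))) :
    IsClosed (realIdentityComponent GC : Set (GL (Fin N) ℝ)) :=
  (isClosed_realPoints hGC).isClosedEmbedding_subtypeVal.isClosedMap _ isClosed_connectedComponent

theorem isConnected_realIdentityComponent (GC : Subgroup (GL (Fin N) ℂ)) :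
    IsConnected (realIdentityComponent GC : Set (GL (Fin N) ℝ)) :=
  isConnected_connectedComponent.image _ continuous_subtype_val.continuousOn

/-- The matrix case of `ae_stabilizer_inf_eq_bot`. -/
theorem ae_stabilizer_inf_eq_bot_matrix {G : Type*} [Group G] [TopologicalSpace G]
    [IsTopologicalGroup G] [LocallyCompactSpace G] [SecondCountableTopology G] [T2Space G]
    [ConnectedSpace G] (ι : G →* GL (Fin N) ℝ) (hι : Continuous ι) (hinj : Function.Injective ι)
    {𝔥 : Submodule ℝ (Matrix (Fin N) (Fin N) ℝ)} (h𝔥 : ∀ X ∈ 𝔥, ∀ Y ∈ 𝔥, X * Y - Y * X ∈ 𝔥)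
    {H : Subgroup G}
    (hH : H.map ι = Subgroup.closure
      {g : GL (Fin N) ℝ | ∃ Y ∈ 𝔥, (g : Matrix (Fin N) (Fin N) ℝ) = NormedSpace.exp Y})
    (hcore : {h : G | ∀ g : G, g * h * g⁻¹ ∈ H}.Finite)
    (Γ : Subgroup G) [DiscreteTopology Γ] (hΓ : ∀ γ ∈ Γ, IsOfFinOrder γ → γ = 1)
    [MeasurableSpace (G ⧸ Γ)] [BorelSpace (G ⧸ Γ)] {μ : Measure (G ⧸ Γ)}
    (hμ : IsInvariantProbability Γ μ) : ∀ᵐ x ∂μ, MulAction.stabilizer G x ⊓ H = ⊥ := by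
  let _ : NormedRing (Matrix (Fin N) (Fin N) ℝ) := Matrix.linftyOpNormedRing
  let _ : NormedAlgebra ℝ (Matrix (Fin N) (Fin N) ℝ) := Matrix.linftyOpNormedAlgebra
  exact ae_stabilizer_inf_eq_bot (A := Matrix (Fin N) (Fin N) ℝ) ι hι hinj h𝔥 hH hcore Γ hΓ hμ

end RealPoints

theorem mainTheorem7 {N : ℕ} (GC : Subgroup (GL (Fin N) ℂ))
    (hGC : IsConnectedAlgebraicGroupOverReal GC)
    (Γ : Subgroup (realIdentityComponent GC))
    (hΓ : IsLatticeSubgroup Γ)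
    (hΓtf : ∀ γ ∈ Γ, IsOfFinOrder γ → γ = 1)
    (H : Subgroup (realIdentityComponent GC))
    (hH : IsConnectedSemisimpleLieSubgroup (H.map (realIdentityComponent GC).subtype))
    (hcore : (⋂ g : realIdentityComponent GC,
      (fun h => g * h * g⁻¹) '' (H : Set (realIdentityComponent GC))).Finite)
    [MeasurableSpace (realIdentityComponent GC ⧸ Γ)] [BorelSpace (realIdentityComponent GC ⧸ Γ)]
    (μ : Measure (realIdentityComponent GC ⧸ Γ)) (hμ : IsInvariantProbability Γ μ) :
    ∀ᵐ x ∂μ, MulAction.stabilizer (realIdentityComponent GC) x ⊓ H = ⊥ := by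
  have hemb := isOpenEmbedding_generalLinearGroup_val (N := N)
  have _ : SecondCountableTopology (Matrix (Fin N) (Fin N) ℝ) :=
    inferInstanceAs (SecondCountableTopology (Fin N → Fin N → ℝ))
  have _ : LocallyCompactSpace (Matrix (Fin N) (Fin N) ℝ) :=
    inferInstanceAs (LocallyCompactSpace (Fin N → Fin N → ℝ))
  have _ : SecondCountableTopology (GL (Fin N) ℝ) := hemb.isEmbedding.secondCountableTopology
  have _ : LocallyCompactSpace (GL (Fin N) ℝ) := hemb.locallyCompactSpace
  have _ : T2Space (GL (Fin N) ℝ) := hemb.isEmbedding.t2Space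
  have _ : LocallyCompactSpace (realIdentityComponent GC) :=
    (isClosed_realIdentityComponent hGC.closed).isClosedEmbedding_subtypeVal.locallyCompactSpace
  have _ : SecondCountableTopology (realIdentityComponent GC) :=
    IsEmbedding.subtypeVal.secondCountableTopology
  have _ : ConnectedSpace (realIdentityComponent GC) :=
    isConnected_iff_connectedSpace.1 (isConnected_realIdentityComponent GC)
  have _ : DiscreteTopology Γ := hΓ.discrete
  obtain ⟨𝔥, -, h𝔥⟩ := hH
  let _ : LieRing (Matrix (Fin N) (Fin N) ℝ) := LieRing.ofAssociativeRing
  have hlie : ∀ X ∈ 𝔥.toSubmodule, ∀ Y ∈ 𝔥.toSubmodule, X * Y - Y * X ∈ 𝔥.toSubmodule :=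
    fun X hX Y hY => 𝔥.lie_mem hX hY
  refine ae_stabilizer_inf_eq_bot_matrix
    (realIdentityComponent GC).subtype continuous_subtype_val Subtype.val_injective hlie h𝔥 ?_ Γ
    hΓtf hμ
  refine hcore.subset fun h hh => mem_iInter.2 fun g => ?_
  exact ⟨g⁻¹ * h * g, by simpa using hh g⁻¹, by group⟩
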